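/- All rings are commutative with $1$. Let $(R,\mathfrak m,K)$ be a local ring with maximal ideal $\mathfrak m$ and residue field $K=R/\mathfrak m$; a bar denotes reduction of coefficients modulo $\mathfrak m$. An \emph{étale neighborhood} of $R$ is a pair $(S,\mathfrak q)$ where $S$ is an étale $R$-algebra (i.e. formally étale and finitely presented) and $\mathfrak q$ is a prime ideal of $S$ lying over $\mathfrak m$ such that the induced map of residue fields $K\to S_{\mathfrak q}/\mathfrak q S_{\mathfrak q}$ is an isomorphism. A \emph{pointed étale extension} of $R$ is an $R$-algebra $T$ that is isomorphic to $S_{\mathfrak q}$ for some étale neighborhood $(S,\mathfrak q)$ of $R$. \textbf{Theorem.} The following conditions are equivalent: (1) $R$ is Henselian, that is: for every monic $f\in R[t]$ and all monic coprime $p_0,q_0\in K[t]$ with $\bar f=p_0q_0$ there is a unique pair of monic polynomials $p,q\in R[t]$ with $\bar p=p_0$, $\bar q=q_0$, $\deg p=\deg p_0$, $\deg q=\deg q_0$ and $f=pq$. (2) If $f\in R[t]$ is a monic polynomial and $\lambda\in K$ is a simple root of $\bar f\in K[t]$, then there is an $r\in R$ with $r\equiv\lambda \bmod \mathfrak m$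 and $f(r)=0$. (3) For every pointed étale extension $T$ of $R$ one has $R\cong T$ as $R$-algebras. (4) For every $n\in\mathbb N$ and all $f_1,\dots,f_n\in R[x_1,\dots,x_n]$ and $(\lambda_1,\dots,\lambda_n)\in K^n$ such that $\bar f_j(\lambda_1,\dots,\lambda_n)=0$ for all $j$ and the reduction modulo $\mathfrak m$ of the Jacobian determinant $\det\left(\frac{\partial f_j}{\partial x_i}\right)$ does not vanish at $(\lambda_1,\dots,\lambda_n)$, there are unique $r_1,\dots,r_n\in R$ such that $r_i\equiv\lambda_i \bmod\mathfrak m$ for all $i$ and $f_j(r_1,\dots,r_n)=0$ for all $j$. -/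

import Mathlib

universe u

open Polynomial IsLocalRing

/-- Hensel's property for a local ring `R`: every factorization of the reduction of a monic
polynomial into two monic coprime polynomials over the residue field lifts uniquely to a
factorization into two monic polynomials over `R` of the same degrees. -/
def IsHenselian (R : Type u) [CommRing R] [IsLocalRing R] : Prop :=
  ∀ f : R[X], f.Monic → ∀ p₀ q₀ : (ResidueField R)[X], p₀.Monic → q₀.Monic → IsCoprime p₀ q₀ →
    f.map (residue R) = p₀ * q₀ →
    ∃! pq : R[X] × R[X], pq.1.Monic ∧ pq.2.Monic ∧
      pq.1.map (residue R) = p₀ ∧ pq.2.map (residue R) = q₀ ∧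
      pq.1.degree = p₀.degree ∧ pq.2.degree = q₀.degree ∧ f = pq.1 * pq.2

/-- If `q` lies over the maximal ideal of `R`, then `R → S_q` is a local homomorphism, so that it
induces a map of residue fields. -/
theorem isLocalHom_algebraMap_localizationAtPrime (R S : Type u) [CommRing R] [IsLocalRing R]
    [CommRing S] [Algebra R S] (q : Ideal S) [q.IsPrime] [h : q.LiesOver (maximalIdeal R)] :
    IsLocalHom (algebraMap R (Localization.AtPrime q)) := by
  constructor
  intro a ha
  by_contra hn
  have ham : a ∈ maximalIdeal R := hn
  rw [h.over, Ideal.mem_comap] at ham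
  rw [IsScalarTower.algebraMap_apply R S (Localization.AtPrime q),
    IsLocalization.AtPrime.isUnit_to_map_iff (Localization.AtPrime q) q] at ha
  exact ha ham

/-- `(S, q)` is an étale neighborhood of the local ring `R`: `S` is an étale `R`-algebra and `q` is
a prime ideal of `S` lying over the maximal ideal of `R` such that the induced map of residue
fields from that of `R` to that of `S_q` is an isomorphism. -/
structure IsEtaleNeighborhood (R S : Type u) [CommRing R] [IsLocalRing R] [CommRing S]
    [Algebra R S] (q : Ideal S) [q.IsPrime] : Prop where
  etale : Algebra.Etale R S
  liesOver : q.LiesOver (maximalIdeal R)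
  bijective_residueField :
    haveI := isLocalHom_algebraMap_localizationAtPrime R S q
    Function.Bijective (ResidueField.map (algebraMap R (Localization.AtPrime q)))

/-- The `R`-algebra `T` is a pointed étale extension of the local ring `R`: it is (as an
`R`-algebra) the localization `S_q` for some étale neighborhood `(S, q)` of `R`. Every étale
`R`-algebra is finitely presented, so the universe of `R` contains a copy of each of them. -/
def IsPointedEtaleExtension (R T : Type u) [CommRing R] [IsLocalRing R] [CommRing T]
    [Algebra R T] : Prop :=
  ∃ (S : Type u) (_ : CommRing S) (_ : Algebra R S) (_ : Algebra S T) (_ : IsScalarTower R S T)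
    (q : Ideal S) (_ : q.IsPrime), IsEtaleNeighborhood R S q ∧ IsLocalization.AtPrime T q

/-! All four conditions amount to one lifting property: for every étale `S` over `R`, each
`R`-algebra map `S → K` lifts uniquely to `S → R`. Étale neighborhoods of `R` inside `S` are the
kernels of such maps.

Étale algebras are locally standard étale, so lifting simple roots lifts points. A lifted point `σ :
S → R` forces `R = S_q`: its kernel is finitely generated and idempotent, so Nakayama kills it in
`S_q`. Conversely, `S_q ≅ R` yields the unique lift.

Coprime monic factorizations of `f`, and common zeros with invertible Jacobian, are the points of
suitable étale algebras; this gives (1) and (4). Each contains (2): split off a linear factor, or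
take `n = 1`. -/

/-! ### Étale algebras, their residue field points and sections -/

/-- A section of a formally unramified algebra has idempotent kernel. -/
theorem ker_le_sq_of_formallyUnramified {R S : Type*} [CommRing R] [CommRing S] [Algebra R S]
    [Algebra.FormallyUnramified R S] (σ : S →ₐ[R] R) :
    RingHom.ker σ ≤ RingHom.ker σ ^ 2 := by
  set J := RingHom.ker σ
  have hle : J ^ 2 ≤ J := Ideal.pow_le_self two_ne_zero
  -- Both maps agree modulo the square-zero ideal `J / J ^ 2`, so they coincide; the right one kills
  -- `J`.
  have key : (Ideal.Quotient.mkₐ R (J ^ 2)) =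
      (Algebra.ofId R (S ⧸ J ^ 2)).comp σ := by
    refine Algebra.FormallyUnramified.lift_unique_of_ringHom (Ideal.Quotient.factor hle) ⟨2, ?_⟩
      _ _ ?_
    · rw [Ideal.Quotient.factor_ker, ← Ideal.map_pow, Ideal.map_quotient_self]
      rfl
    · ext s
      simp only [RingHom.comp_apply, RingHom.coe_coe, Ideal.Quotient.mkₐ_eq_mk,
        AlgHom.comp_apply, Ideal.Quotient.factor_mk, Algebra.ofId_apply]
      rw [IsScalarTower.algebraMap_apply R S (S ⧸ J ^ 2), Ideal.Quotient.algebraMap_eq,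
        Ideal.Quotient.factor_mk, Ideal.Quotient.eq, RingHom.mem_ker]
      simp
  intro x hx
  rw [← Ideal.Quotient.eq_zero_iff_mem]
  have := congr($key x)
  simpa [(RingHom.mem_ker).mp hx] using this

/-- If an étale algebra `S` over a local ring `R` has a section `σ`, then `R` is the local ring of
`S` at the inverse image of the maximal ideal under `σ`. -/
theorem bijective_algebraMap_of_section {R S T : Type*} [CommRing R] [IsLocalRing R] [CommRing S]
    [Algebra R S] [Algebra.Etale R S] [CommRing T] [Algebra R T] [Algebra S T]
    [IsScalarTower R S T] (σ : S →ₐ[R] R) (q : Ideal S) [q.IsPrime]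
    (hq : q = (maximalIdeal R).comap σ) [IsLocalization.AtPrime T q] :
    Function.Bijective (algebraMap R T) := by
  have hunit : ∀ y : q.primeCompl, IsUnit (σ y) := fun y ↦ by
    by_contra hy
    exact y.2 (hq.ge hy)
  have hfg : (RingHom.ker σ).FG :=
    Algebra.FinitePresentation.ker_fG_of_surjective σ fun r ↦ ⟨algebraMap R S r, by simp⟩
  have : IsLocalRing T := IsLocalization.AtPrime.isLocalRing T q
  -- Nakayama: the kernel is finitely generated, idempotent and contained in `q`.
  have hJ : (RingHom.ker σ).map (algebraMap S T) = ⊥ := by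
    refine Submodule.eq_bot_of_le_smul_of_le_jacobson_bot
      ((RingHom.ker σ).map (algebraMap S T)) _ (hfg.map _) ?_ ?_
    · rw [smul_eq_mul, ← sq, ← Ideal.map_pow]
      exact Ideal.map_mono (ker_le_sq_of_formallyUnramified σ)
    · rw [IsLocalRing.jacobson_eq_maximalIdeal _ bot_ne_top, Ideal.map_le_iff_le_comap,
        ← Ideal.under_def, IsLocalization.AtPrime.under_maximalIdeal T q, hq]
      intro x hx
      rw [Ideal.mem_comap, (RingHom.mem_ker).mp hx]
      exact zero_mem _
  have hσ (s : S) : algebraMap S T s = algebraMap R T (σ s) := by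
    have h : s - algebraMap R S (σ s) ∈ RingHom.ker σ := by simp [RingHom.mem_ker]
    have h' := Ideal.mem_map_of_mem (algebraMap S T) h
    rwa [hJ, Ideal.mem_bot, map_sub, sub_eq_zero, ← IsScalarTower.algebraMap_apply] at h'
  constructor
  · let χ : T →ₐ[R] R := IsLocalization.liftAlgHom (M := q.primeCompl) (f := σ) hunit
    have hcomp : χ.comp (Algebra.ofId R T) = AlgHom.id R R := by ext
    exact Function.LeftInverse.injective (g := χ) (fun r ↦ congr($hcomp r))
  · intro t
    obtain ⟨s, y, rfl⟩ := IsLocalization.exists_mk'_eq q.primeCompl t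
    refine ⟨σ s * ↑(hunit y).unit⁻¹, ?_⟩
    rw [IsLocalization.eq_mk'_iff_mul_eq, hσ, hσ, ← map_mul, mul_assoc]
    simp

/-- A homomorphism from an étale algebra `S` to the residue field makes its kernel an étale
neighborhood. -/
theorem isEtaleNeighborhood_of_ker_eq {R S : Type u} [CommRing R] [IsLocalRing R] [CommRing S]
    [Algebra R S] [Algebra.Etale R S] (φ : S →ₐ[R] ResidueField R) (q : Ideal S) [q.IsPrime]
    (hq : RingHom.ker φ = q) : IsEtaleNeighborhood R S q := by
  have hφ (r : R) : φ (algebraMap R S r) = residue R r := φ.commutes r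
  have hlies : q.LiesOver (maximalIdeal R) := ⟨by
    ext r
    rw [Ideal.mem_comap, ← hq, RingHom.mem_ker, hφ, residue_eq_zero_iff]⟩
  refine ⟨inferInstance, hlies, ?_⟩
  have := isLocalHom_algebraMap_localizationAtPrime R S q
  refine ⟨RingHom.injective _, fun x ↦ ?_⟩
  obtain ⟨t, rfl⟩ := residue_surjective x
  obtain ⟨s, y, rfl⟩ := IsLocalization.exists_mk'_eq q.primeCompl t
  have hy : φ y ≠ 0 := fun h ↦ y.2 (hq.le h)
  -- With this `r`, the element `r y - s` lies in `ker φ = q`, so `r` and `s / y` have the same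
  -- residue.
  obtain ⟨r, hr⟩ := residue_surjective (φ s / φ y)
  refine ⟨residue R r, ?_⟩
  rw [ResidueField.map_residue, ← sub_eq_zero, ← map_sub, residue_eq_zero_iff,
    ← Ideal.mul_unit_mem_iff_mem _ (IsLocalization.map_units (Localization.AtPrime q) y), sub_mul,
    IsLocalization.mk'_spec, IsScalarTower.algebraMap_apply R S (Localization.AtPrime q),
    ← map_mul, ← map_sub, IsLocalization.AtPrime.to_map_mem_maximal_iff _ q]
  refine hq.le ?_
  rw [RingHom.mem_ker, map_sub, map_mul, hφ, hr, div_mul_cancel₀ _ hy, sub_self]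

/-- An étale neighborhood comes from a homomorphism to the residue field. -/
theorem IsEtaleNeighborhood.exists_algHom {R S : Type u} [CommRing R] [IsLocalRing R] [CommRing S]
    [Algebra R S] {q : Ideal S} [q.IsPrime] (h : IsEtaleNeighborhood R S q) :
    ∃ φ : S →ₐ[R] ResidueField R, RingHom.ker φ = q := by
  have := h.liesOver
  have := isLocalHom_algebraMap_localizationAtPrime R S q
  let e := RingEquiv.ofBijective _ h.bijective_residueField
  let φ : S →+* ResidueField R := (e.symm : _ →+* ResidueField R).comp
    ((residue (Localization.AtPrime q)).comp (algebraMap S _))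
  refine ⟨⟨φ, fun r ↦ ?_⟩, ?_⟩
  · change e.symm _ = _
    rw [RingEquiv.symm_apply_eq, RingHom.comp_apply, ← IsScalarTower.algebraMap_apply]
    rfl
  · ext s
    rw [RingHom.mem_ker]
    change e.symm _ = 0 ↔ _
    rw [map_eq_zero_iff _ e.symm.injective, RingHom.comp_apply, residue_eq_zero_iff,
      IsLocalization.AtPrime.to_map_mem_maximal_iff _ q]

/-- If simple roots of monic polynomials lift, then residue field points of étale algebras lift. -/
theorem exists_algHom_of_forall_simple_root {R S : Type*} [CommRing R] [IsLocalRing R] [CommRing S]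
    [Algebra R S] [Algebra.Etale R S]
    (H : ∀ f : R[X], f.Monic → ∀ a : ResidueField R, (f.map (residue R)).rootMultiplicity a = 1 →
      ∃ r : R, residue R r = a ∧ f.eval r = 0) (φ : S →ₐ[R] ResidueField R) :
    ∃ ψ : S →ₐ[R] R, ∀ s, residue R (ψ s) = φ s := by
  have hprime : (RingHom.ker φ).IsPrime := RingHom.ker_isPrime _
  -- Since `φ f ≠ 0`, `φ` extends to the standard étale algebra `S[1/f]`, where it is determined by
  -- a simple root of a monic polynomial.
  obtain ⟨f, hf, hstd⟩ := Algebra.IsEtaleAt.exists_isStandardEtale (R := R) (RingHom.ker φ)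
  obtain ⟨P⟩ := hstd.nonempty_standardEtalePresentation
  let φ' : Localization.Away f →ₐ[R] ResidueField R :=
    IsLocalization.Away.liftAlgHom f (f := φ) (isUnit_iff_ne_zero.mpr hf)
  have ha : P.P.HasMap (φ' P.x) := P.hasMap.map φ'
  have hres (p : R[X]) (r : R) : aeval (residue R r) p = residue R (aeval r p) :=
    aeval_algebraMap_apply (ResidueField R) r p
  have hder := ha.isUnit_derivative_f.ne_zero
  have hroot := ha.1
  have hne : P.f.map (residue R) ≠ 0 := (P.monic_f.map _).ne_zero
  obtain ⟨r, hr, hfr⟩ := H P.f P.monic_f (φ' P.x) (by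
    rw [aeval_def, ← eval_map] at hder hroot
    rw [← derivative_map] at hder
    apply le_antisymm
    · rw [← not_lt, one_lt_rootMultiplicity_iff_isRoot hne]
      exact fun h ↦ hder h.2
    · exact (rootMultiplicity_pos hne).mpr hroot)
  have hr' : P.P.HasMap r := by
    refine ⟨hfr, ?_⟩
    have := ha.2
    rw [← hr, hres] at this
    exact isUnit_of_map_unit (residue R) _ this
  refine ⟨((P.P.lift r hr').comp P.equivRing.toAlgHom).comp
    (IsScalarTower.toAlgHom R S (Localization.Away f)), fun s ↦ ?_⟩
  have key : (Algebra.ofId R (ResidueField R)).comp (P.P.lift r hr') =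
      φ'.comp P.equivRing.symm.toAlgHom := by
    refine P.P.hom_ext ?_
    simpa using hr
  have h₁ := congr($key (P.equivRing (algebraMap S _ s)))
  refine Eq.trans h₁ ?_
  simp [φ']

theorem nonempty_algEquiv_of_forall_simple_root {R T : Type u} [CommRing R] [IsLocalRing R]
    [CommRing T] [Algebra R T]
    (H : ∀ f : R[X], f.Monic → ∀ a : ResidueField R, (f.map (residue R)).rootMultiplicity a = 1 →
      ∃ r : R, residue R r = a ∧ f.eval r = 0) (hT : IsPointedEtaleExtension R T) :
    Nonempty (R ≃ₐ[R] T) := by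
  obtain ⟨S, _, _, _, _, q, _, hS, _⟩ := hT
  have := hS.etale
  obtain ⟨φ, hφ⟩ := hS.exists_algHom
  obtain ⟨ψ, hψ⟩ := exists_algHom_of_forall_simple_root H φ
  have hq : q = (maximalIdeal R).comap ψ := by
    ext s
    rw [← hφ, RingHom.mem_ker, Ideal.mem_comap, ← hψ, residue_eq_zero_iff]
  exact ⟨AlgEquiv.ofBijective (Algebra.ofId R T) (bijective_algebraMap_of_section ψ q hq)⟩

/-- If all pointed étale extensions are trivial, then residue field points of étale algebras lift
uniquely. -/
theorem existsUnique_algHom_of_forall_isPointedEtaleExtension {R S : Type u} [CommRing R]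
    [IsLocalRing R] [CommRing S] [Algebra R S] [Algebra.Etale R S]
    (H : ∀ (T : Type u) [CommRing T] [Algebra R T],
      IsPointedEtaleExtension R T → Nonempty (R ≃ₐ[R] T)) (φ : S →ₐ[R] ResidueField R) :
    ∃! ψ : S →ₐ[R] R, ∀ s, residue R (ψ s) = φ s := by
  let q := RingHom.ker φ
  have hprime : q.IsPrime := RingHom.ker_isPrime _
  obtain ⟨e⟩ := H (Localization.AtPrime q)
    ⟨S, _, _, _, inferInstance, q, hprime, isEtaleNeighborhood_of_ker_eq φ q rfl, inferInstance⟩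
  let ψ : S →ₐ[R] R := e.symm.toAlgHom.comp (IsScalarTower.toAlgHom R S _)
  refine ⟨ψ, fun s ↦ ?_, fun ψ' hψ' ↦ ?_⟩
  · obtain ⟨r, hr⟩ := residue_surjective (φ s)
    have hmem : s - algebraMap R S r ∈ q := by
      rw [RingHom.mem_ker, map_sub, sub_eq_zero, φ.commutes, ← hr]
      rfl
    rw [← hr, ← sub_eq_zero, ← map_sub, residue_eq_zero_iff]
    have : ψ s - r = e.symm (algebraMap S (Localization.AtPrime q) (s - algebraMap R S r)) := by
      rw [map_sub, map_sub, ← IsScalarTower.algebraMap_apply, e.symm.commutes]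
      rfl
    rw [this, mem_maximalIdeal, mem_nonunits_iff, MulEquiv.isUnit_map,
      IsLocalization.AtPrime.isUnit_to_map_iff _ q]
    exact fun h ↦ h hmem
  · have hunit : ∀ y : q.primeCompl, IsUnit (ψ' y) := fun y ↦ by
      refine isUnit_of_map_unit (residue R) _ ?_
      rw [hψ', isUnit_iff_ne_zero]
      exact y.2
    -- Any lift factors through `S_q ≅ R`, and `R` has only one `R`-algebra endomorphism.
    let χ : Localization.AtPrime q →ₐ[R] R :=
      IsLocalization.liftAlgHom (M := q.primeCompl) (f := ψ') hunit
    have hχ : χ = e.symm.toAlgHom := by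
      have : χ.comp e.toAlgHom = AlgHom.id R R := by ext
      refine AlgHom.ext fun t ↦ ?_
      have h := congr($this (e.symm t))
      simpa using h
    ext s
    have h := congr($hχ (algebraMap S _ s))
    simpa [χ, ψ] using h

/-! ### Factorizations of monic polynomials -/

/-- Coprimality of two monic polynomials over a local ring can be checked over the residue field. -/
theorem isCoprime_of_isCoprime_map_residue {R : Type*} [CommRing R] [IsLocalRing R] {p q : R[X]}
    (hp : p.Monic) (hq : q.Monic) (h : IsCoprime (p.map (residue R)) (q.map (residue R))) :
    IsCoprime p q := by
  -- Coprimality means that the resultant is a unit. Reduction preserves the degrees of monic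
  -- polynomials, hence commutes with the resultant, and it reflects units.
  rw [← isUnit_resultant_iff_isCoprime (hp.map _), hp.natDegree_map, hq.natDegree_map,
    resultant_map_map] at h
  exact (isUnit_resultant_iff_isCoprime hp).mp (isUnit_of_map_unit _ _ h)

/-- The universal coprime factorization ring of `f` is étale, and its points are the coprime monic
factorizations of `f` in the given degrees. -/
theorem isHenselian_of_forall_existsUnique_algHom {R : Type u} [CommRing R] [IsLocalRing R]
    (H : ∀ (S : Type u) [CommRing S] [Algebra R S] [Algebra.Etale R S]
      (φ : S →ₐ[R] ResidueField R), ∃! ψ : S →ₐ[R] R, ∀ s, residue R (ψ s) = φ s) :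
    IsHenselian R := by
  intro f hf p₀ q₀ hp₀ hq₀ hcop hfac
  have hdeg : f.natDegree = p₀.natDegree + q₀.natDegree := by
    rw [← hp₀.natDegree_mul hq₀, ← hfac, hf.natDegree_map]
  let F : MonicDegreeEq R f.natDegree := .mk f hf rfl
  let E := UniversalCoprimeFactorizationRing.homEquiv (ResidueField R) _ _ hdeg F
  let E' := UniversalCoprimeFactorizationRing.homEquiv R _ _ hdeg F
  let φ := E.symm ⟨(.mk p₀ hp₀ rfl, .mk q₀ hq₀ rfl), hfac.symm, hcop⟩
  let π : R →ₐ[R] ResidueField R := Algebra.ofId R (ResidueField R)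
  -- By naturality of `homEquiv`, lifting the point is lifting the two factors.
  have hE (ψ) : (∀ s, residue R (ψ s) = φ s) ↔
      (E' ψ).1.1.1.map (residue R) = p₀ ∧ (E' ψ).1.2.1.map (residue R) = q₀ := by
    have h₁ : (∀ s, residue R (ψ s) = φ s) ↔ π.comp ψ = φ :=
      (AlgHom.ext_iff (φ₁ := π.comp ψ) (φ₂ := φ)).symm
    rw [h₁, Equiv.eq_symm_apply, Subtype.ext_iff, Prod.ext_iff,
      UniversalCoprimeFactorizationRing.homEquiv_comp_fst,
      UniversalCoprimeFactorizationRing.homEquiv_comp_snd, Subtype.ext_iff, Subtype.ext_iff]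
    rfl
  obtain ⟨ψ, hψ, huniq⟩ := H _ φ
  obtain ⟨h₁, h₂⟩ := (hE ψ).mp hψ
  refine ⟨((E' ψ).1.1.1, (E' ψ).1.2.1), ⟨(E' ψ).1.1.monic, (E' ψ).1.2.monic, h₁, h₂, ?_, ?_, ?_⟩,
    ?_⟩
  · rw [MonicDegreeEq.degree, degree_eq_natDegree hp₀.ne_zero]
  · rw [MonicDegreeEq.degree, degree_eq_natDegree hq₀.ne_zero]
  · simpa [F] using (E' ψ).2.1.symm
  · rintro ⟨p, q⟩ ⟨hp, hq, hp', hq', -, -, hpq⟩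
    dsimp only at hp hq hp' hq' hpq
    have hpd : p.natDegree = p₀.natDegree := by rw [← hp', hp.natDegree_map]
    have hqd : q.natDegree = q₀.natDegree := by rw [← hq', hq.natDegree_map]
    let ψ' := E'.symm ⟨(.mk p hp hpd, .mk q hq hqd), by simpa [F] using hpq.symm,
      isCoprime_of_isCoprime_map_residue hp hq (by
        change IsCoprime (p.map _) (q.map _)
        rwa [hp', hq'])⟩
    have hψ' : ψ' = ψ := huniq ψ' ((hE ψ').mpr (by simp [ψ', hp', hq']))
    rw [← hψ']
    simp [ψ']

/-- A simple root `a` splits off a factor `X - a` coprime to the cofactor; its lift is monic of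
degree one and so has a root. -/
theorem exists_root_of_isHenselian {R : Type u} [CommRing R] [IsLocalRing R] (H : IsHenselian R)
    {f : R[X]} (hf : f.Monic) {a : ResidueField R}
    (ha : (f.map (residue R)).rootMultiplicity a = 1) :
    ∃ r : R, residue R r = a ∧ f.eval r = 0 := by
  have hne : f.map (residue R) ≠ 0 := (hf.map _).ne_zero
  obtain ⟨q₀, hq₀, hndvd⟩ := exists_eq_pow_rootMultiplicity_mul_and_not_dvd _ hne a
  rw [ha, pow_one] at hq₀
  have hcop : IsCoprime (X - C a) q₀ :=
    ((irreducible_X_sub_C a).coprime_iff_not_dvd).mpr hndvd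
  obtain ⟨⟨p, q⟩, ⟨hp, -, hp', -, hdeg, -, hpq⟩, -⟩ := H f hf (X - C a) q₀ (monic_X_sub_C a)
    ((monic_X_sub_C a).of_mul_monic_left (hq₀ ▸ hf.map _)) hcop hq₀
  dsimp only at hp hp' hdeg hpq
  rw [degree_X_sub_C] at hdeg
  have hpX := hp.eq_X_add_C (natDegree_eq_of_degree_eq_some hdeg)
  refine ⟨-p.coeff 0, ?_, ?_⟩
  · have := congr(($hp').coeff 0)
    rw [coeff_map] at this
    simp [this]
  · rw [hpq, eval_mul]
    conv in eval _ p => rw [hpX]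
    simp

/-! ### Systems of `n` equations in `n` variables -/

section Jacobian

variable {R : Type u} [CommRing R] {n : ℕ} (f : Fin n → MvPolynomial (Fin n) R)

/-- The étale locus of the quotient of a polynomial ring in `n` variables by `n` equations. -/
abbrev JacobianLocalization : Type u :=
  Localization.Away (Ideal.Quotient.mk (Ideal.span (Set.range f))
    (Matrix.det (Matrix.of fun i j => MvPolynomial.pderiv i (f j))))

/-- Inverting the determinant makes the presentation submersive. There are as many relations as
variables, so the relative dimension is zero; the localization adds one of each. -/
instance JacobianLocalization.etale : Algebra.Etale R (JacobianLocalization f) := by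
  let P := Algebra.PreSubmersivePresentation.naive (v := f) id Function.injective_id
  have hjac : P.jacobian = Ideal.Quotient.mk (Ideal.span (Set.range f))
      (Matrix.det (Matrix.of fun i j => MvPolynomial.pderiv i (f j))) := by
    have hmat : P.jacobiMatrix = Matrix.of fun i j => MvPolynomial.pderiv i (f j) := by
      ext i j : 1
      exact P.jacobiMatrix_apply i j
    rw [P.jacobian_eq_jacobiMatrix_det, hmat, P.algebraMap_apply]
    exact congr($((MvPolynomial.aeval_unique (Ideal.Quotient.mkₐ R _)).symm) _)
  let Q : Algebra.SubmersivePresentation R (JacobianLocalization f) _ _ :=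
    { toPreSubmersivePresentation := .comp (.localizationAway (JacobianLocalization f)
        (Ideal.Quotient.mk (Ideal.span (Set.range f))
          (Matrix.det (Matrix.of fun i j => MvPolynomial.pderiv i (f j))))) P
      jacobian_isUnit := by
        simp [Algebra.smul_def, -isUnit_map_iff, hjac, IsLocalization.Away.algebraMap_isUnit] }
  have : Algebra.IsStandardSmoothOfRelativeDimension 0 R (JacobianLocalization f) :=
    ⟨_, _, _, inferInstance, Q, by
      simp only [Algebra.PreSubmersivePresentation.dimension_comp_eq_dimension_add_dimension, Q]
      simp [Algebra.Presentation.dimension]⟩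
  infer_instance

/-- The canonical map from the polynomial ring. -/
noncomputable def JacobianLocalization.ofMvPolynomial :
    MvPolynomial (Fin n) R →ₐ[R] JacobianLocalization f :=
  (IsScalarTower.toAlgHom R (MvPolynomial (Fin n) R ⧸ Ideal.span (Set.range f)) _).comp
    (Ideal.Quotient.mkₐ R (Ideal.span (Set.range f)))

theorem JacobianLocalization.comp_ofMvPolynomial_apply {A : Type*} [CommRing A] [Algebra R A]
    (ψ : JacobianLocalization f →ₐ[R] A) (p : MvPolynomial (Fin n) R) :
    MvPolynomial.aeval (fun i ↦ ψ (ofMvPolynomial f (.X i))) p = ψ (ofMvPolynomial f p) :=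
  congr($((MvPolynomial.aeval_unique (ψ.comp (ofMvPolynomial f))).symm) p)

theorem JacobianLocalization.algHom_ext {A : Type*} [CommRing A] [Algebra R A]
    {ψ ψ' : JacobianLocalization f →ₐ[R] A}
    (h : ∀ i, ψ (ofMvPolynomial f (.X i)) = ψ' (ofMvPolynomial f (.X i))) : ψ = ψ' := by
  refine IsLocalization.algHom_ext (.powers (Ideal.Quotient.mk (Ideal.span (Set.range f))
    (Matrix.det (Matrix.of fun i j => MvPolynomial.pderiv i (f j))))) ?_
  exact Ideal.Quotient.algHom_ext _ (MvPolynomial.algHom_ext h)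

/-- The homomorphism given by a common zero of the polynomials `f j` at which the Jacobian
determinant is invertible. -/
noncomputable def JacobianLocalization.lift {A : Type*} [CommRing A] [Algebra R A] (r : Fin n → A)
    (hr : ∀ j, MvPolynomial.aeval r (f j) = 0)
    (hu : IsUnit (MvPolynomial.aeval r
      (Matrix.det (Matrix.of fun i j => MvPolynomial.pderiv i (f j))))) :
    JacobianLocalization f →ₐ[R] A :=
  IsLocalization.Away.liftAlgHom (Ideal.Quotient.mk (Ideal.span (Set.range f))
      (Matrix.det (Matrix.of fun i j => MvPolynomial.pderiv i (f j))))
    (f := Ideal.Quotient.liftₐ (Ideal.span (Set.range f)) (MvPolynomial.aeval r)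
      (Ideal.span_le (I := RingHom.ker _).mpr (by rintro _ ⟨j, rfl⟩; exact hr j))) hu

theorem JacobianLocalization.lift_ofMvPolynomial_X {A : Type*} [CommRing A] [Algebra R A]
    (r : Fin n → A) (hr : ∀ j, MvPolynomial.aeval r (f j) = 0)
    (hu : IsUnit (MvPolynomial.aeval r
      (Matrix.det (Matrix.of fun i j => MvPolynomial.pderiv i (f j))))) (i : Fin n) :
    lift f r hr hu (ofMvPolynomial f (.X i)) = r i := by
  refine Eq.trans ?_ (MvPolynomial.aeval_X (R := R) r i)
  exact IsLocalization.Away.lift_eq (S := JacobianLocalization f)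
    (Ideal.Quotient.mk (Ideal.span (Set.range f))
      (Matrix.det (Matrix.of fun i j => MvPolynomial.pderiv i (f j)))) hu _

/-- Homomorphisms out of `JacobianLocalization f` are the common zeros of the polynomials `f j` at
which the Jacobian determinant is invertible. -/
noncomputable def JacobianLocalization.homEquiv (A : Type*) [CommRing A] [Algebra R A] :
    (JacobianLocalization f →ₐ[R] A) ≃ { r : Fin n → A // (∀ j, MvPolynomial.aeval r (f j) = 0) ∧
      IsUnit (MvPolynomial.aeval r
        (Matrix.det (Matrix.of fun i j => MvPolynomial.pderiv i (f j)))) } where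
  toFun ψ := ⟨fun i ↦ ψ (ofMvPolynomial f (.X i)), fun j ↦ by
      rw [comp_ofMvPolynomial_apply]
      have : Ideal.Quotient.mk (Ideal.span (Set.range f)) (f j) = 0 :=
        Ideal.Quotient.eq_zero_iff_mem.mpr (Ideal.subset_span ⟨j, rfl⟩)
      simp [ofMvPolynomial, this], by
      rw [comp_ofMvPolynomial_apply]
      exact (IsLocalization.Away.algebraMap_isUnit (Ideal.Quotient.mk (Ideal.span (Set.range f))
        (Matrix.det (Matrix.of fun i j => MvPolynomial.pderiv i (f j))))).map ψ⟩
  invFun r := lift f r.1 r.2.1 r.2.2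
  left_inv _ := algHom_ext f fun _ ↦ lift_ofMvPolynomial_X ..
  right_inv _ := Subtype.ext (_root_.funext fun _ ↦ lift_ofMvPolynomial_X ..)

theorem existsUnique_root_of_forall_existsUnique_algHom [IsLocalRing R]
    (H : ∀ (S : Type u) [CommRing S] [Algebra R S] [Algebra.Etale R S]
      (φ : S →ₐ[R] ResidueField R), ∃! ψ : S →ₐ[R] R, ∀ s, residue R (ψ s) = φ s)
    (a : Fin n → ResidueField R)
    (hroot : ∀ j, MvPolynomial.eval a (MvPolynomial.map (residue R) (f j)) = 0)
    (hjac : MvPolynomial.eval a (MvPolynomial.map (residue R)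
      (Matrix.det (Matrix.of fun i j => MvPolynomial.pderiv i (f j)))) ≠ 0) :
    ∃! r : Fin n → R, (∀ i, residue R (r i) = a i) ∧ ∀ j, MvPolynomial.eval r (f j) = 0 := by
  have hev (p : MvPolynomial (Fin n) R) :
      MvPolynomial.eval a (MvPolynomial.map (residue R) p) = MvPolynomial.aeval a p := by
    rw [MvPolynomial.eval_map]
    rfl
  simp only [hev] at hroot hjac
  let E := JacobianLocalization.homEquiv f (ResidueField R)
  let E' := JacobianLocalization.homEquiv f R
  let φ := E.symm ⟨a, hroot, isUnit_iff_ne_zero.mpr hjac⟩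
  have hφ (i) : φ (JacobianLocalization.ofMvPolynomial f (.X i)) = a i :=
    congr_fun (congr_arg Subtype.val (E.apply_symm_apply ⟨a, hroot, isUnit_iff_ne_zero.mpr hjac⟩)) i
  obtain ⟨ψ, hψ, huniq⟩ := H _ φ
  refine ⟨(E' ψ).1, ⟨fun i ↦ (hψ _).trans (hφ i), (E' ψ).2.1⟩, ?_⟩
  rintro r ⟨hr, hfr⟩
  have hr' : a = algebraMap R (ResidueField R) ∘ r := funext fun i ↦ (hr i).symm
  -- The Jacobian at `r` reduces to the nonzero Jacobian at `a`, so it is a unit and `r` defines a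
  -- point.
  let ψ' := E'.symm ⟨r, hfr, isUnit_of_map_unit (residue R) _ (by
    rw [hr', MvPolynomial.aeval_algebraMap_apply] at hjac
    exact isUnit_iff_ne_zero.mpr hjac)⟩
  have hEψ' : (E' ψ').1 = r := congr_arg Subtype.val (E'.apply_symm_apply _)
  have hψ' : ψ' = ψ := huniq ψ' (by
    have : (Algebra.ofId R (ResidueField R)).comp ψ' = φ :=
      JacobianLocalization.algHom_ext f fun i ↦ by
        rw [hφ, ← hr i, ← hEψ']
        rfl
    exact fun s ↦ congr($this s))
  rw [← hEψ', hψ']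

end Jacobian

/-- For `n = 1` the Jacobian determinant is the derivative, which does not vanish at a simple root.
-/
theorem exists_root_of_multivariate {R : Type u} [CommRing R] [IsLocalRing R]
    (H : ∀ (n : ℕ) (f : Fin n → MvPolynomial (Fin n) R) (a : Fin n → ResidueField R),
          (∀ j, MvPolynomial.eval a (MvPolynomial.map (residue R) (f j)) = 0) →
          MvPolynomial.eval a (MvPolynomial.map (residue R)
            (Matrix.det (Matrix.of fun i j => MvPolynomial.pderiv i (f j)))) ≠ 0 →
          ∃! r : Fin n → R, (∀ i, residue R (r i) = a i) ∧
            ∀ j, MvPolynomial.eval r (f j) = 0)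
    {f : R[X]} (hf : f.Monic) {a : ResidueField R}
    (ha : (f.map (residue R)).rootMultiplicity a = 1) :
    ∃ r : R, residue R r = a ∧ f.eval r = 0 := by
  have hne : f.map (residue R) ≠ 0 := (hf.map _).ne_zero
  have hroot : (f.map (residue R)).IsRoot a :=
    (rootMultiplicity_pos hne).mp (by rw [ha]; exact one_pos)
  have hder : ¬ (derivative (f.map (residue R))).IsRoot a := fun h ↦
    (one_lt_rootMultiplicity_iff_isRoot hne).mpr ⟨hroot, h⟩ |>.ne' ha
  have hev (p : R[X]) (b : Fin 1 → ResidueField R) :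
      MvPolynomial.eval b (MvPolynomial.map (residue R) (aeval (MvPolynomial.X 0) p)) = (p.map (residue R)).eval (b 0) := by
    rw [MvPolynomial.eval_map]
    change MvPolynomial.aeval b (aeval (MvPolynomial.X 0) p) = _
    rw [← aeval_algHom_apply, MvPolynomial.aeval_X, eval_map]
    rfl
  obtain ⟨r, ⟨hr, hfr⟩, -⟩ := H 1 (fun _ ↦ aeval (MvPolynomial.X 0) f) (fun _ ↦ a)
    (fun _ ↦ by rw [hev]; exact hroot) (by
      rw [Matrix.det_unique]
      simp only [Matrix.of_apply, Derivation.map_aeval]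
      simpa [hev, derivative_map] using hder)
  refine ⟨r 0, hr 0, ?_⟩
  have h := hfr 0
  change MvPolynomial.aeval r (aeval (MvPolynomial.X 0) f) = 0 at h
  rwa [← aeval_algHom_apply, MvPolynomial.aeval_X] at h

theorem mainTheorem7 (R : Type u) [CommRing R] [IsLocalRing R] :
    List.TFAE
      [IsHenselian R,
        ∀ f : R[X], f.Monic → ∀ a : ResidueField R,
          (f.map (residue R)).rootMultiplicity a = 1 →
          ∃ r : R, residue R r = a ∧ f.eval r = 0,
        ∀ (T : Type u) [CommRing T] [Algebra R T],
          IsPointedEtaleExtension R T → Nonempty (R ≃ₐ[R] T),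
        ∀ (n : ℕ) (f : Fin n → MvPolynomial (Fin n) R) (a : Fin n → ResidueField R),
          (∀ j, MvPolynomial.eval a (MvPolynomial.map (residue R) (f j)) = 0) →
          MvPolynomial.eval a (MvPolynomial.map (residue R)
            (Matrix.det (Matrix.of fun i j => MvPolynomial.pderiv i (f j)))) ≠ 0 →
          ∃! r : Fin n → R, (∀ i, residue R (r i) = a i) ∧
            ∀ j, MvPolynomial.eval r (f j) = 0] := by
  tfae_have 1 → 2 := fun H _ hf _ ha ↦ exists_root_of_isHenselian H hf ha
  tfae_have 2 → 3 := fun H _ _ _ hT ↦ nonempty_algEquiv_of_forall_simple_root H hT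
  tfae_have 3 → 1 := fun H ↦ isHenselian_of_forall_existsUnique_algHom fun _ _ _ _ φ ↦
    existsUnique_algHom_of_forall_isPointedEtaleExtension H φ
  tfae_have 3 → 4 := fun H _ f ↦ existsUnique_root_of_forall_existsUnique_algHom f
    fun _ _ _ _ φ ↦ existsUnique_algHom_of_forall_isPointedEtaleExtension H φ
  tfae_have 4 → 2 := fun H _ hf _ ha ↦ exists_root_of_multivariate H hf ha
  tfae_finish
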